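/- Let $\mathbb{H}=\{z\in\mathbb{C}:\operatorname{Im}z>0\}$ and let $$d_{\mathbb{H}}(z,w)=\frac12\log\frac{1+\rho(z,w)}{1-\rho(z,w)},\qquad \rho(z,w)=\left|\frac{z-w}{z-\overline{w}}\right| ,\qquad z,w\in\mathbb{H},$$ be the hyperbolic distance. Let $f:\mathbb{H}\to\mathbb{H}$ be holomorphic and parabolic with Denjoy–Wolff point $\infty$, that is, $f$ has no fixed point in $\mathbb{H}$, $f^n(z)\to\infty$ for all $z\in\mathbb{H}$, and $f$ has angular derivative $\angle\lim_{z\to\infty}f(z)/z=1$. Suppose that $f$ has positive hyperbolic step, that is, $\lim_{n\to\infty}d_{\mathbb{H}}(f^{n+1}(z),f^n(z))>0$ for some $z\in\mathbb{H}$ (equivalently, for all $z\in\mathbb{H}$). Call $f$ of *extremal rate* if $\lim_{n\to\infty}f^n(z)/n$ exists and belongs to $\mathbb{R}\setminus\{0\}$ for some $z\in\mathbb{H}$, and of *finite shift* if $\lim_{n\to\infty}\operatorname{Im}f^n(z)<+\infty$ for some $z\in\mathbb{H}$. Then $f$ is of extremal rate if and only if it is of finite shift, and $f$ is of extremal rate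 if and only if the limit $$\lim_{n\to\infty}\bigl(d_{\mathbb{H}}(i,f^n(z))-\log n\bigr)$$ exists in $\mathbb{R}$ for all $z\in\mathbb{H}$. Moreover, if any of these conditions holds, then for every $z\in\mathbb{H}$ the limit $L(z)=\lim_{n\to\infty}f^n(z)/n$ exists in $\mathbb{R}\setminus\{0\}$ and is independent of $z$, the limit $I(z)=\lim_{n\to\infty}\operatorname{Im}f^n(z)$ exists in $(0,+\infty)$, and $$\lim_{n\to\infty}\bigl(d_{\mathbb{H}}(i,f^n(z))-\log n\bigr)=\log\frac{|L(z)|}{\sqrt{I(z)}} .$$ -/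

import Mathlib

open Filter Topology UpperHalfPlane
open scoped Manifold

noncomputable section

namespace HalfPlaneDynamics

/-- The pseudo-hyperbolic distance in the upper half-plane. -/
def pseudoHypDist (z w : ℍ) : ℝ :=
  ‖((z : ℂ) - (w : ℂ)) / ((z : ℂ) - (starRingEnd ℂ) (w : ℂ))‖

/-- The hyperbolic distance in the upper half-plane, with the normalization of curvature `-4`
(half of Mathlib's `dist` on `ℍ`). -/
def hypDist (z w : ℍ) : ℝ :=
  (1 / 2) * Real.log ((1 + pseudoHypDist z w) / (1 - pseudoHypDist z w))

/-- The trace on `ℍ` of the neighbourhoods of `∞` in the Riemann sphere. -/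
def atInfinity : Filter ℍ := comap (fun z : ℍ => (z : ℂ)) (cocompact ℂ)

/-- `AngularTendsto g l`: the angular (non-tangential) limit of `g` at `∞` is `l`, that is,
`g` tends to `l` as `z → ∞` within each sector `|Re z| ≤ R * Im z`. -/
def AngularTendsto (g : ℍ → ℂ) (l : ℂ) : Prop :=
  ∀ R : ℝ, 0 < R → Tendsto g (atInfinity ⊓ 𝓟 {z : ℍ | |z.re| ≤ R * z.im}) (𝓝 l)

/-- `f` is a parabolic holomorphic self-map of `ℍ` with Denjoy–Wolff point `∞`. -/
structure IsParabolicAtInfinity (f : ℍ → ℍ) : Prop where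
  holomorphic : MDifferentiable 𝓘(ℂ) 𝓘(ℂ) f
  /-- `f` is non-elliptic. -/
  nonelliptic : ∀ z, f z ≠ z
  /-- All orbits converge to the Denjoy–Wolff point `∞`. -/
  denjoyWolff : ∀ z, Tendsto (fun n : ℕ => f^[n] z) atTop atInfinity
  /-- The angular derivative of `f` at `∞` is `1`. -/
  angularDeriv : AngularTendsto (fun z => (f z : ℂ) / (z : ℂ)) 1

/-- `f` is of positive hyperbolic step. -/
def PositiveHyperbolicStep (f : ℍ → ℍ) : Prop :=
  ∃ z : ℍ, ∃ s : ℝ, 0 < s ∧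
    Tendsto (fun n : ℕ => hypDist (f^[n + 1] z) (f^[n] z)) atTop (𝓝 s)

/-- `f` (parabolic of positive hyperbolic step) is of extremal rate: `f^n(z) / n` converges to
a non-zero real number for some `z`. -/
def ExtremalRate (f : ℍ → ℍ) : Prop :=
  ∃ z : ℍ, ∃ L : ℝ, L ≠ 0 ∧
    Tendsto (fun n : ℕ => (f^[n] z : ℂ) / (n : ℂ)) atTop (𝓝 (L : ℂ))

/-- `f` is of finite shift: `Im f^n(z)` has a finite limit for some `z`. -/
def FiniteShift (f : ℍ → ℍ) : Prop :=
  ∃ z : ℍ, ∃ I : ℝ, Tendsto (fun n : ℕ => (f^[n] z).im) atTop (𝓝 I)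

end HalfPlaneDynamics

end

namespace HalfPlaneDynamics

variable {f : ℍ → ℍ}

open scoped ComplexConjugate

/-! Julia's lemma gives `Im f(z) ≥ Im z`, so the displacement `f z - z` maps `ℍ` into the closed
upper half-plane and Schwarz–Pick applies to it as well as to `f`. Write `yₙ` for the heights of an
orbit `zₙ`, and `sinhSq z w = |z - w|² / (Im z Im w)`, which `f` does not increase. Positive step
means `sinhSq zₙ₊₁ zₙ ↓ D > 0` for some orbit. The main estimate is `mul_sq_le_sinhSq`: `sinhSq zₙ₊ₘ
zₙ ≥ D m²`. Since `sinhSq zₙ₊₁ zₙ` converges to a nonzero limit, Schwarz–Pick for the displacement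
is nearly an equality, so ratios of consecutive steps and of consecutive heights share their limits.
Along a subsequence the orbit looks geometric of some ratio `A ≥ 1`, where the bound is AM-GM;
monotonicity in `n` carries it back to every `n`. If `|zₙ| = O(n √yₙ)`, which both extremal rate and
convergence of `d(i, zₙ) - log n` imply, dividing the main estimate by `m²` and letting `m → ∞`
bounds `yₙ`. Conversely, if `yₙ` is bounded, Schwarz–Pick bounds the variation of the displacements
by the telescoping sum of height increments. They converge to a real `L` with `L² = D (lim yₙ)² ≠
0`; Cesàro means and the explicit formula for `d(i, z)` give the asymptotics. -/

/-! ### Schwarz–Pick and Julia inequalities. -/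

theorem norm_sub_conj_sq (z w : ℂ) :
    ‖z - conj w‖ ^ 2 = ‖z - w‖ ^ 2 + 4 * (z.im * w.im) := by
  simp only [← Complex.normSq_eq_norm_sq, Complex.normSq_apply, Complex.sub_re, Complex.sub_im,
    Complex.conj_re, Complex.conj_im]
  ring

theorem sub_conj_ne_zero {z w : ℂ} (hz : 0 < z.im) (hw : 0 < w.im) : z - conj w ≠ 0 := by
  intro h
  have := congrArg Complex.im h
  simp at this
  linarith

/-- The Schwarz–Pick inequality for holomorphic self-maps of the upper half-plane. -/
theorem schwarzPick_of_pos {g : ℂ → ℂ} (hd : DifferentiableOn ℂ g {z | 0 < z.im})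
    (hg : ∀ z : ℂ, 0 < z.im → 0 < (g z).im) {z w : ℂ} (hz : 0 < z.im) (hw : 0 < w.im) :
    ‖g z - g w‖ ^ 2 * (z.im * w.im) ≤ ‖z - w‖ ^ 2 * ((g z).im * (g w).im) := by
  -- `C` is the Cayley map from the disc to the half-plane with `C 0 = w`; conjugating `g` by such
  -- maps gives `h` with `h 0 = 0`, ready for the Schwarz lemma.
  set C : ℂ → ℂ := fun ζ => (w - conj w * ζ) / (1 - ζ) with hC
  have hne : ∀ ζ ∈ Metric.ball (0 : ℂ) 1, 1 - ζ ≠ 0 := by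
    intro ζ hζ h
    rw [← sub_eq_zero.1 h] at hζ
    simp at hζ
  have hCim : ∀ ζ ∈ Metric.ball (0 : ℂ) 1, 0 < (C ζ).im := by
    intro ζ hζ
    have h1 := hne ζ hζ
    have h2 : (C ζ).im = w.im * (1 - ‖ζ‖ ^ 2) / Complex.normSq (1 - ζ) := by
      simp only [hC, Complex.div_im, ← Complex.normSq_eq_norm_sq]
      rw [← sub_div]
      congr 1
      simp [Complex.normSq_apply]
      ring
    rw [h2]
    have h3 : ‖ζ‖ < 1 := by simpa using hζ
    have h4 : 0 < 1 - ‖ζ‖ ^ 2 := by nlinarith [norm_nonneg ζ]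
    have h5 := Complex.normSq_pos.2 h1
    positivity
  set h : ℂ → ℂ := fun ζ => (g (C ζ) - g w) / (g (C ζ) - conj (g w)) with hh
  have hCd : DifferentiableOn ℂ C (Metric.ball 0 1) := by
    intro ζ hζ
    have := hne ζ hζ
    apply DifferentiableAt.differentiableWithinAt
    simp only [hC]
    fun_prop (disch := assumption)
  have hgC : DifferentiableOn ℂ (fun ζ => g (C ζ)) (Metric.ball 0 1) := hd.comp hCd hCim
  have hhd : DifferentiableOn ℂ h (Metric.ball 0 1) :=
    (hgC.sub_const _).div (hgC.sub_const _)
      fun ζ hζ => sub_conj_ne_zero (hg _ (hCim ζ hζ)) (hg w hw)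
  have hmaps : Set.MapsTo h (Metric.ball 0 1) (Metric.closedBall 0 1) := by
    intro ζ hζ
    have h1 := hg _ (hCim ζ hζ)
    have h2 := hg w hw
    simp only [hh, mem_closedBall_zero_iff, norm_div]
    apply div_le_one_of_le₀ _ (norm_nonneg _)
    apply le_of_sq_le_sq _ (norm_nonneg _)
    rw [norm_sub_conj_sq]
    nlinarith [mul_pos h1 h2]
  have h0 : h 0 = 0 := by simp [hh, hC]
  have hzw := sub_conj_ne_zero hz hw
  have hww := sub_conj_ne_zero hw hw
  have e1 := norm_sub_conj_sq z w
  have e2 := norm_sub_conj_sq (g z) (g w)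
  have p1 := mul_pos hz hw
  have p2 := mul_pos (hg z hz) (hg w hw)
  have n1 : 0 < ‖z - conj w‖ := norm_pos_iff.2 hzw
  have n2 : 0 < ‖g z - conj (g w)‖ := norm_pos_iff.2 (sub_conj_ne_zero (hg z hz) (hg w hw))
  have hζ : ‖(z - w) / (z - conj w)‖ < 1 := by
    rw [norm_div, div_lt_one n1]
    apply lt_of_pow_lt_pow_left₀ 2 n1.le
    linarith
  have key := Complex.norm_le_norm_of_mapsTo_ball hhd hmaps h0 hζ
  have hCz : C ((z - w) / (z - conj w)) = z := by
    simp only [hC]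
    have : 1 - (z - w) / (z - conj w) = (w - conj w) / (z - conj w) := by
      field_simp
      ring
    rw [this]
    field_simp
    ring
  simp only [hh, hCz, norm_div] at key
  rw [div_le_div_iff₀ n2 n1] at key
  have key2 := pow_le_pow_left₀ (by positivity) key 2
  rw [mul_pow, mul_pow, e1, e2] at key2
  nlinarith

/-- The Schwarz–Pick inequality for holomorphic maps into the closed upper half-plane. -/
theorem schwarzPick {g : ℂ → ℂ} (hd : DifferentiableOn ℂ g {z | 0 < z.im})
    (hg : ∀ z : ℂ, 0 < z.im → 0 ≤ (g z).im) {z w : ℂ} (hz : 0 < z.im) (hw : 0 < w.im) :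
    ‖g z - g w‖ ^ 2 * (z.im * w.im) ≤ ‖z - w‖ ^ 2 * ((g z).im * (g w).im) := by
  have h1 : ∀ ε > (0 : ℝ), ‖g z - g w‖ ^ 2 * (z.im * w.im) ≤
      ‖z - w‖ ^ 2 * (((g z).im + ε) * ((g w).im + ε)) := by
    intro ε hε
    have := schwarzPick_of_pos (g := fun z => g z + ε * Complex.I) (hd.add_const _)
      (fun z hz => by simpa using add_pos_of_nonneg_of_pos (hg z hz) hε) hz hw
    simpa using this
  have h2 : Tendsto (fun ε : ℝ => ‖z - w‖ ^ 2 * (((g z).im + ε) * ((g w).im + ε))) (𝓝[>] 0)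
      (𝓝 (‖z - w‖ ^ 2 * (((g z).im + 0) * ((g w).im + 0)))) := by
    apply Tendsto.mono_left _ nhdsWithin_le_nhds
    exact Continuous.tendsto (by fun_prop) 0
  rw [add_zero, add_zero] at h2
  exact ge_of_tendsto h2 (eventually_mem_nhdsWithin.mono fun ε hε => h1 ε hε)

theorem differentiableOn_coe_comp_ofComplex (hf : MDifferentiable 𝓘(ℂ) 𝓘(ℂ) f) :
    DifferentiableOn ℂ (fun z : ℂ => (f (ofComplex z) : ℂ)) {z | 0 < z.im} :=
  mdifferentiable_iff.1 (mdifferentiable_coe.comp hf)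

theorem schwarzPick_self (hf : MDifferentiable 𝓘(ℂ) 𝓘(ℂ) f) (z w : ℍ) :
    ‖(f z : ℂ) - f w‖ ^ 2 * (z.im * w.im) ≤ ‖(z : ℂ) - w‖ ^ 2 * ((f z).im * (f w).im) := by
  have := schwarzPick (differentiableOn_coe_comp_ofComplex hf)
    (fun z _ => (f (ofComplex z)).im_pos.le) z.im_pos w.im_pos
  simpa using this

/-- Julia's lemma at `∞`, for angular derivative `1`. -/
theorem IsParabolicAtInfinity.im_le (hf : IsParabolicAtInfinity f) (z : ℍ) :
    z.im ≤ (f z).im := by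
  -- Schwarz–Pick is applied to `z` and a point `it` of the imaginary axis, then divided by `t³` as
  -- `t → ∞`.
  let w : ℕ → ℍ := fun n => ⟨((n + 1 : ℝ) : ℂ) * Complex.I, by simp; positivity⟩
  have hw : Tendsto w atTop (atInfinity ⊓ 𝓟 {z : ℍ | |z.re| ≤ 1 * z.im}) := by
    rw [tendsto_inf, tendsto_principal]
    constructor
    · rw [atInfinity, tendsto_comap_iff, ← Metric.cobounded_eq_cocompact,
        tendsto_norm_atTop_iff_cobounded.symm]
      have : ∀ n, ‖((fun z : ℍ => (z : ℂ)) ∘ w) n‖ = (n : ℝ) + 1 := by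
        intro n
        simp only [w, Function.comp, norm_mul, Complex.norm_I, mul_one, Complex.norm_real]
        exact abs_of_nonneg (by positivity)
      simp only [this]
      exact tendsto_atTop_add_const_right _ _ tendsto_natCast_atTop_atTop
    · refine Eventually.of_forall fun n => ?_
      have h1 : (w n).re = 0 := by rw [← coe_re]; simp [w]
      have h2 := (w n).im_pos
      simp only [Set.mem_ofPred_eq, h1, abs_zero]
      positivity
  have hu := (hf.angularDeriv 1 one_pos).comp hw
  set u : ℕ → ℂ := (fun z : ℍ => (f z : ℂ) / (z : ℂ)) ∘ w with hu_def
  have ht : Tendsto (fun n : ℕ => (((n + 1 : ℝ) : ℂ))⁻¹) atTop (𝓝 0) := by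
    have := tendsto_one_div_add_atTop_nhds_zero_nat (𝕜 := ℂ)
    simpa using this
  have key : ∀ n : ℕ, ‖(f z : ℂ) * (((n + 1 : ℝ) : ℂ))⁻¹ - u n * Complex.I‖ ^ 2 * z.im ≤
      ‖(z : ℂ) * (((n + 1 : ℝ) : ℂ))⁻¹ - Complex.I‖ ^ 2 * ((f z).im * (u n).re) := by
    intro n
    have h := schwarzPick_self hf.holomorphic z (w n)
    set t : ℝ := (n + 1 : ℝ) with ht'
    have tpos : 0 < t := by positivity
    have tne : (t : ℂ) ≠ 0 := by exact_mod_cast tpos.ne'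
    have e1 : ((w n : ℍ) : ℂ) = t * Complex.I := rfl
    have e2 : (f (w n) : ℂ) = u n * (t * Complex.I) := by
      rw [← e1, hu_def]
      exact (div_mul_cancel₀ _ (w n).ne_zero).symm
    have e3 : (w n).im = t := by simp [← coe_im, e1]
    have e4 : (f (w n)).im = (u n).re * t := by
      rw [← coe_im, e2]; simp
    rw [e2, e4, e3, e1] at h
    have e5 : (f z : ℂ) - u n * (t * Complex.I) = t * ((f z : ℂ) * (t : ℂ)⁻¹ - u n * Complex.I) := by
      field_simp
    have e6 : (z : ℂ) - t * Complex.I = t * ((z : ℂ) * (t : ℂ)⁻¹ - Complex.I) := by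
      field_simp
    rw [e5, e6, norm_mul, norm_mul, Complex.norm_real, Real.norm_of_nonneg tpos.le] at h
    have t3 : 0 < t ^ 3 := by positivity
    refine le_of_mul_le_mul_left ?_ t3
    linarith
  have l1 : Tendsto (fun n : ℕ => ‖(f z : ℂ) * (((n + 1 : ℝ) : ℂ))⁻¹ - u n * Complex.I‖ ^ 2 * z.im)
      atTop (𝓝 (‖(f z : ℂ) * 0 - 1 * Complex.I‖ ^ 2 * z.im)) :=
    (((tendsto_const_nhds.mul ht).sub (hu.mul_const _)).norm.pow 2).mul_const _
  have l2 : Tendsto (fun n : ℕ => ‖(z : ℂ) * (((n + 1 : ℝ) : ℂ))⁻¹ - Complex.I‖ ^ 2 *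
      ((f z).im * (u n).re)) atTop
      (𝓝 (‖(z : ℂ) * 0 - Complex.I‖ ^ 2 * ((f z).im * (1 : ℂ).re))) :=
    (((tendsto_const_nhds.mul ht).sub_const _).norm.pow 2).mul
      (tendsto_const_nhds.mul ((Complex.continuous_re.tendsto _).comp hu))
  simpa using le_of_tendsto_of_tendsto' l1 l2 key

/-- The Schwarz–Pick inequality for the displacement `z ↦ f z - z`. -/
theorem IsParabolicAtInfinity.schwarzPick_displacement (hf : IsParabolicAtInfinity f) (z w : ℍ) :
    ‖((f z : ℂ) - z) - ((f w : ℂ) - w)‖ ^ 2 * (z.im * w.im) ≤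
      ‖(z : ℂ) - w‖ ^ 2 * (((f z).im - z.im) * ((f w).im - w.im)) := by
  have := schwarzPick (g := fun z : ℂ => (f (ofComplex z) : ℂ) - z)
    ((differentiableOn_coe_comp_ofComplex hf.holomorphic).sub differentiableOn_id)
    (fun z hz => by
      have := hf.im_le ⟨z, hz⟩
      rw [Complex.sub_im, sub_nonneg, ofComplex_apply_of_im_pos hz]
      exact this) z.im_pos w.im_pos
  simpa using this

/-! ### The invariant `sinhSq` and the hyperbolic distance. -/

/-- `sinhSq z w = 4 sinh² d(z, w)` in the normalization of `hypDist`. -/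
noncomputable def sinhSq (z w : ℍ) : ℝ := ‖(z : ℂ) - w‖ ^ 2 / (z.im * w.im)

theorem sinhSq_nonneg (z w : ℍ) : 0 ≤ sinhSq z w := by
  have := z.im_pos
  have := w.im_pos
  unfold sinhSq
  positivity

theorem norm_sq_eq_sinhSq (z w : ℍ) : ‖(z : ℂ) - w‖ ^ 2 = sinhSq z w * (z.im * w.im) := by
  have := z.im_pos
  have := w.im_pos
  unfold sinhSq
  field_simp

theorem sinhSq_map_le (hf : MDifferentiable 𝓘(ℂ) 𝓘(ℂ) f) (z w : ℍ) :
    sinhSq (f z) (f w) ≤ sinhSq z w := by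
  unfold sinhSq
  rw [div_le_div_iff₀ (mul_pos (f z).im_pos (f w).im_pos) (mul_pos z.im_pos w.im_pos)]
  exact schwarzPick_self hf z w

theorem antitone_sinhSq_iterate (hf : MDifferentiable 𝓘(ℂ) 𝓘(ℂ) f) (z w : ℍ) :
    Antitone fun n : ℕ => sinhSq (f^[n] z) (f^[n] w) := by
  refine antitone_nat_of_succ_le fun n => ?_
  rw [Function.iterate_succ_apply', Function.iterate_succ_apply']
  exact sinhSq_map_le hf _ _

theorem IsParabolicAtInfinity.monotone_im_iterate (hf : IsParabolicAtInfinity f) (z : ℍ) :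
    Monotone fun n : ℕ => (f^[n] z).im := by
  refine monotone_nat_of_le_succ fun n => ?_
  rw [Function.iterate_succ_apply']
  exact hf.im_le _

/-- With `r = Im z / Im w`, the vertical part of the distance alone gives `r + 1/r - 2 ≤ K`. -/
theorem im_le_mul_of_sinhSq_le {z w : ℍ} {K : ℝ} (h : sinhSq z w ≤ K) :
    z.im ≤ (K + 2) * w.im := by
  have hz := z.im_pos
  have hw := w.im_pos
  have h1 := norm_sq_eq_sinhSq z w
  have h2 : (z.im - w.im) ^ 2 ≤ ‖(z : ℂ) - w‖ ^ 2 := by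
    rw [← Complex.normSq_eq_norm_sq, Complex.normSq_apply]
    simp
    nlinarith [mul_self_nonneg (z.re - w.re)]
  have h3 : sinhSq z w * (z.im * w.im) ≤ K * (z.im * w.im) := by gcongr
  by_contra hc
  push Not at hc
  nlinarith [mul_pos hz hw, mul_pos hw hw, mul_lt_mul_of_pos_left hc hz]

theorem pseudoHypDist_sq (z w : ℍ) :
    pseudoHypDist z w ^ 2 = sinhSq z w / (sinhSq z w + 4) := by
  have hz := z.im_pos
  have hw := w.im_pos
  have h := norm_sub_conj_sq z w
  rw [pseudoHypDist, norm_div, div_pow, h, coe_im, coe_im, norm_sq_eq_sinhSq]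
  have := sinhSq_nonneg z w
  field_simp

/-- Positive hyperbolic step, in terms of `sinhSq`. -/
theorem PositiveHyperbolicStep.exists_tendsto_sinhSq (hf : MDifferentiable 𝓘(ℂ) 𝓘(ℂ) f)
    (hs : PositiveHyperbolicStep f) :
    ∃ z : ℍ, ∃ D : ℝ, 0 < D ∧
      Tendsto (fun n : ℕ => sinhSq (f^[n + 1] z) (f^[n] z)) atTop (𝓝 D) := by
  obtain ⟨z, s, hs, hlim⟩ := hs
  refine ⟨z, _, ?_, tendsto_atTop_ciInf (antitone_sinhSq_iterate hf (f z) z)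
    ⟨0, Set.forall_mem_range.2 fun n => sinhSq_nonneg _ _⟩⟩
  have hD := tendsto_atTop_ciInf (antitone_sinhSq_iterate hf (f z) z)
    ⟨0, Set.forall_mem_range.2 fun n => sinhSq_nonneg _ _⟩
  set D := ⨅ n : ℕ, sinhSq (f^[n] (f z)) (f^[n] z)
  have hD0 : 0 ≤ D := ge_of_tendsto' hD fun n => sinhSq_nonneg _ _
  -- If `D` were `0`, the pseudo-hyperbolic and hence the hyperbolic steps would tend to `0`.
  refine hD0.lt_of_ne fun h => hs.ne' ?_
  rw [← h] at hD
  have hρ : Tendsto (fun n : ℕ => pseudoHypDist (f^[n + 1] z) (f^[n] z)) atTop (𝓝 0) := by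
    have e : ∀ n : ℕ, pseudoHypDist (f^[n + 1] z) (f^[n] z) =
        √(sinhSq (f^[n] (f z)) (f^[n] z) / (sinhSq (f^[n] (f z)) (f^[n] z) + 4)) := fun n => by
      rw [← Function.iterate_succ_apply f, ← pseudoHypDist_sq, Real.sqrt_sq]
      exact norm_nonneg _
    simp only [e]
    have := (hD.div (hD.add_const 4) (by norm_num)).sqrt
    simpa using this
  have hd : Tendsto (fun n : ℕ => hypDist (f^[n + 1] z) (f^[n] z)) atTop
      (𝓝 ((1 / 2) * Real.log ((1 + 0) / (1 - 0)))) :=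
    (((hρ.const_add 1).div (hρ.const_sub 1) (by norm_num)).log (by norm_num)).const_mul _
  simpa using tendsto_nhds_unique hlim hd

theorem hypDist_I (z : ℍ) :
    hypDist UpperHalfPlane.I z =
      Real.log ((‖(z : ℂ) + Complex.I‖ + ‖(z : ℂ) - Complex.I‖) / (2 * √z.im)) := by
  have hz := z.im_pos
  have h := norm_sub_conj_sq z Complex.I
  rw [Complex.conj_I, sub_neg_eq_add, Complex.I_im, coe_im, mul_one] at h
  have hρ : pseudoHypDist UpperHalfPlane.I z =
      ‖(z : ℂ) - Complex.I‖ / ‖(z : ℂ) + Complex.I‖ := by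
    rw [pseudoHypDist, norm_div, coe_I, norm_sub_rev]
    congr 1
    rw [← Complex.norm_conj ((z : ℂ) + Complex.I), map_add, Complex.conj_I, norm_sub_rev,
      sub_eq_add_neg]
  rw [hypDist, hρ]
  set a := ‖(z : ℂ) + Complex.I‖
  set b := ‖(z : ℂ) - Complex.I‖
  have ha0 : 0 ≤ a := norm_nonneg _
  have hb : 0 ≤ b := norm_nonneg _
  have ha : 0 < a := by
    rcases ha0.eq_or_lt with h0 | h0
    · rw [← h0] at h; nlinarith
    · exact h0
  have hab : b < a := by nlinarith
  have hs : √z.im ^ 2 = z.im := Real.sq_sqrt hz.le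
  have hs0 := Real.sqrt_pos.2 hz
  -- This is `(a + b) / (a - b) = (a + b)² / (a² - b²)` with `a² - b² = 4 Im z`.
  have e : (1 + b / a) / (1 - b / a) = ((a + b) / (2 * √z.im)) ^ 2 := by
    have : a - b ≠ 0 := by linarith
    have h1 : 1 - b / a ≠ 0 := by
      rw [one_sub_div ha.ne']
      exact div_ne_zero this ha.ne'
    rw [div_pow, mul_pow, hs, div_eq_div_iff h1 (by positivity)]
    field_simp
    linear_combination -h
  rw [e, Real.log_pow]
  push_cast
  ring

/-! ### AM-GM for geometric sums. -/

theorem succ_mul_pow_le {s : ℝ} (hs : 1 ≤ s) (m : ℕ) :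
    (m + 1) * s ^ m ≤ 1 + m * s ^ (m + 1) := by
  induction m with
  | zero => simp
  | succ m ih =>
    have h1 : 0 ≤ (s - 1) * (s ^ (m + 1) - 1) :=
      mul_nonneg (by linarith) (by linarith [one_le_pow₀ hs (n := m + 1)])
    have h2 := mul_le_mul_of_nonneg_right ih (by linarith : 0 ≤ s)
    push_cast
    ring_nf at h1 h2 ⊢
    linarith

/-- The geometric mean of `1, s², …, s^(2(m-1))` is `s^(m-1)`; the extra factor `s` avoids the
exponent `m - 1`. Taking `s = √a` below avoids half-integer powers. -/
theorem natCast_mul_pow_le_geom_sum {s : ℝ} (hs : 1 ≤ s) (m : ℕ) :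
    m * s ^ m ≤ s * ∑ k ∈ Finset.range m, (s ^ 2) ^ k := by
  induction m with
  | zero => simp
  | succ m ih =>
    have h1 := succ_mul_pow_le hs m
    have h3 : ∑ k ∈ Finset.range (m + 1), (s ^ 2) ^ k =
        s ^ 2 * ∑ k ∈ Finset.range m, (s ^ 2) ^ k + 1 := by
      rw [Finset.sum_range_succ', Finset.mul_sum]
      simp [pow_succ, mul_comm]
    rw [h3]
    have h2 := mul_le_mul_of_nonneg_left ih (by positivity : 0 ≤ s ^ 2)
    have h4 := mul_le_mul_of_nonneg_left h1 (by positivity : 0 ≤ s)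
    push_cast
    ring_nf at h2 h4 ⊢
    linarith

theorem sq_mul_pow_le_geom_sum_sq {a : ℝ} (ha : 1 ≤ a) (m : ℕ) :
    (m : ℝ) ^ 2 * a ^ m ≤ a * (∑ k ∈ Finset.range m, a ^ k) ^ 2 := by
  have h := natCast_mul_pow_le_geom_sum (Real.one_le_sqrt.2 ha) m
  have e : √a ^ 2 = a := Real.sq_sqrt (by linarith)
  have h2 := pow_le_pow_left₀ (by positivity) h 2
  rw [e] at h2
  calc (m : ℝ) ^ 2 * a ^ m = (m * √a ^ m) ^ 2 := by
        rw [mul_pow, ← pow_mul, mul_comm m 2, pow_mul, e]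
    _ ≤ _ := h2
    _ = _ := by rw [mul_pow, e]

/-! ### Quadratic growth of `sinhSq` along an orbit. -/

/-- Near-equality in the triangle inequality `‖ω‖ ≤ 1 + ‖ω - 1‖` forces `ω` to be close to
`1 + α`. -/
theorem norm_sub_one_sub_sq_le {ω : ℂ} {α β ε : ℝ} (hα : 0 ≤ α)
    (h1 : ‖ω - 1‖ ^ 2 ≤ α * β) (h2 : (1 + α) * (1 + β) - ε ≤ ‖ω‖ ^ 2) :
    ‖ω - ((1 + α : ℝ) : ℂ)‖ ^ 2 ≤ α * ε := by
  simp only [← Complex.normSq_eq_norm_sq, Complex.normSq_apply, Complex.sub_re, Complex.sub_im,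
    Complex.ofReal_re, Complex.ofReal_im, Complex.one_re, Complex.one_im] at *
  nlinarith [mul_le_mul_of_nonneg_left (sub_nonneg.2 h2) hα, mul_nonneg hα (sub_nonneg.2 h1)]

/-- Subtracting the hypotheses gives `α + β - ε ≤ 2 (Re ω - 1) ≤ 2 √(αβ)`, so AM-GM for `α, β` is
nearly an equality and they are close. -/
theorem sub_sq_le_of_norm_sub_one_sq_le {ω : ℂ} {α β ε : ℝ} (hα : 0 ≤ α) (hβ : 0 ≤ β)
    (hε : 0 ≤ ε) (h1 : ‖ω - 1‖ ^ 2 ≤ α * β) (h2 : (1 + α) * (1 + β) - ε ≤ ‖ω‖ ^ 2) :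
    (β - α) ^ 2 ≤ 2 * ε * (α + β) := by
  simp only [← Complex.normSq_eq_norm_sq, Complex.normSq_apply, Complex.sub_re, Complex.sub_im,
    Complex.one_re, Complex.one_im] at *
  have h3 : α + β - ε ≤ 2 * (ω.re - 1) := by nlinarith
  rcases le_total ε (α + β) with h | h
  · nlinarith [pow_le_pow_left₀ (sub_nonneg.2 h) h3 2, sq_nonneg ω.im, sq_nonneg ε]
  · nlinarith [mul_nonneg hα hβ, mul_nonneg hε (add_nonneg hα hβ),
      mul_le_mul_of_nonneg_right h (add_nonneg hα hβ)]

theorem tendsto_zero_of_sq_le {u b : ℕ → ℝ} (h : ∀ n, u n ^ 2 ≤ b n)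
    (hb : Tendsto b atTop (𝓝 0)) : Tendsto u atTop (𝓝 0) := by
  have h1 : Tendsto (fun n => √(b n)) atTop (𝓝 0) := by simpa using hb.sqrt
  exact squeeze_zero_norm (fun n => Real.abs_le_sqrt (h n)) h1

section QuadraticGrowth

variable {Z : ℕ → ℍ} {D : ℝ}

/-- The ratios of consecutive heights vary slowly, and the ratios of consecutive steps are
asymptotic to them. -/
theorem tendsto_step_ratio (hmono : Monotone fun n => (Z n).im)
    (hanti : Antitone fun n => sinhSq (Z (n + 1)) (Z n)) (hD0 : 0 < D)
    (hD : Tendsto (fun n => sinhSq (Z (n + 1)) (Z n)) atTop (𝓝 D))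
    (hp : ∀ n, ‖((Z (n + 2) : ℂ) - Z (n + 1)) - ((Z (n + 1) : ℂ) - Z n)‖ ^ 2 *
        ((Z (n + 1)).im * (Z n).im) ≤ ‖(Z (n + 1) : ℂ) - Z n‖ ^ 2 *
        (((Z (n + 2)).im - (Z (n + 1)).im) * ((Z (n + 1)).im - (Z n).im))) :
    Tendsto (fun n => (Z (n + 2)).im / (Z (n + 1)).im - (Z (n + 1)).im / (Z n).im) atTop (𝓝 0) ∧
    Tendsto (fun n => ((Z (n + 2) : ℂ) - Z (n + 1)) / ((Z (n + 1) : ℂ) - Z n) -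
      (((Z (n + 1)).im / (Z n).im : ℝ) : ℂ)) atTop (𝓝 0) := by
  set Q : ℕ → ℝ := fun n => sinhSq (Z (n + 1)) (Z n) with hQ
  have hQD : ∀ n, D ≤ Q n := fun n => hanti.le_of_tendsto hD n
  have hQ0 : ∀ n, 0 < Q n := fun n => hD0.trans_le (hQD n)
  set a : ℕ → ℝ := fun n => (Z (n + 1)).im / (Z n).im with ha
  have hy : ∀ n, 0 < (Z n).im := fun n => (Z n).im_pos
  have ha1 : ∀ n, 1 ≤ a n := fun n => (one_le_div (hy n)).2 (hmono n.le_succ)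
  set B := Q 0 + 2
  have hB : 0 < B := by have := hQ0 0; positivity
  have haB : ∀ n, a n ≤ B := fun n =>
    (div_le_iff₀ (hy n)).2 (im_le_mul_of_sinhSq_le (hanti n.zero_le))
  set ω : ℕ → ℂ := fun n => ((Z (n + 2) : ℂ) - Z (n + 1)) / ((Z (n + 1) : ℂ) - Z n) with hω
  have hP : ∀ n, ‖(Z (n + 1) : ℂ) - Z n‖ ^ 2 = Q n * ((Z (n + 1)).im * (Z n).im) :=
    fun n => norm_sq_eq_sinhSq _ _
  have hPpos : ∀ n, 0 < ‖(Z (n + 1) : ℂ) - Z n‖ ^ 2 := fun n => by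
    rw [hP]; exact mul_pos (hQ0 n) (mul_pos (hy _) (hy _))
  have hPne : ∀ n, (Z (n + 1) : ℂ) - Z n ≠ 0 := fun n h => by
    have := hPpos n
    simp [h] at this
  have h1 : ∀ n, ‖ω n - 1‖ ^ 2 ≤ (a n - 1) * (a (n + 1) - 1) := by
    intro n
    have e : ω n - 1 = (((Z (n + 2) : ℂ) - Z (n + 1)) - ((Z (n + 1) : ℂ) - Z n)) /
        ((Z (n + 1) : ℂ) - Z n) := by
      rw [hω, sub_div _ ((Z (n + 1) : ℂ) - Z n), div_self (hPne n)]
    have e2 : (a n - 1) * (a (n + 1) - 1) =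
        (((Z (n + 2)).im - (Z (n + 1)).im) * ((Z (n + 1)).im - (Z n).im)) /
        ((Z (n + 1)).im * (Z n).im) := by
      have := (hy n).ne'
      have := (hy (n + 1)).ne'
      simp only [ha]
      field_simp
    rw [e, e2, norm_div, div_pow, div_le_div_iff₀ (hPpos n) (mul_pos (hy _) (hy _))]
    linarith [hp n]
  have h2 : ∀ n, ‖ω n‖ ^ 2 = Q (n + 1) / Q n * (a n * a (n + 1)) := by
    intro n
    have := (hy n).ne'
    have := (hy (n + 1)).ne'
    have := (hQ0 n).ne'
    rw [hω, norm_div, div_pow, hP n, hP (n + 1)]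
    simp only [ha]
    field_simp
  -- `ε n` is the defect `a n * a (n + 1) - ‖ω n‖ ^ 2`; it vanishes in the limit because `Q` has a
  -- nonzero limit and `a` is bounded.
  set ε : ℕ → ℝ := fun n => (1 - Q (n + 1) / Q n) * (a n * a (n + 1)) with hε
  have hr : ∀ n, 0 ≤ 1 - Q (n + 1) / Q n := fun n =>
    sub_nonneg.2 ((div_le_one (hQ0 n)).2 (hanti n.le_succ))
  have haa : ∀ n, 0 ≤ a n * a (n + 1) := fun n =>
    mul_nonneg (zero_le_one.trans (ha1 _)) (zero_le_one.trans (ha1 _))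
  have hε0 : ∀ n, 0 ≤ ε n := fun n => mul_nonneg (hr n) (haa n)
  have hεlim : Tendsto ε atTop (𝓝 0) := by
    have l1 : Tendsto (fun n => (1 - Q (n + 1) / Q n) * (B * B)) atTop
        (𝓝 ((1 - D / D) * (B * B))) :=
      ((((tendsto_add_atTop_iff_nat 1).2 hD).div hD hD0.ne').const_sub 1).mul_const _
    rw [div_self hD0.ne', sub_self, zero_mul] at l1
    refine squeeze_zero hε0 (fun n => ?_) l1
    exact mul_le_mul_of_nonneg_left
      (mul_le_mul (haB _) (haB _) (zero_le_one.trans (ha1 _)) hB.le) (hr n)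
  have h3 : ∀ n, (1 + (a n - 1)) * (1 + (a (n + 1) - 1)) - ε n ≤ ‖ω n‖ ^ 2 := fun n => by
    rw [h2]
    apply le_of_eq
    simp only [hε]
    ring
  have hα : ∀ n, 0 ≤ a n - 1 := fun n => sub_nonneg.2 (ha1 n)
  constructor
  · refine tendsto_zero_of_sq_le (b := fun n => 4 * B * ε n) (fun n => ?_)
      (by simpa using hεlim.const_mul (4 * B))
    have h := sub_sq_le_of_norm_sub_one_sq_le (hα n) (hα (n + 1)) (hε0 n) (h1 n) (h3 n)
    have h' : a n - 1 + (a (n + 1) - 1) ≤ 2 * B := by linarith [haB n, haB (n + 1)]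
    have h'' := mul_le_mul_of_nonneg_left h' (by linarith [hε0 n] : 0 ≤ 2 * ε n)
    change (a (n + 1) - a n) ^ 2 ≤ _
    calc (a (n + 1) - a n) ^ 2 = (a (n + 1) - 1 - (a n - 1)) ^ 2 := by ring
      _ ≤ _ := h
      _ ≤ _ := h''
      _ = _ := by ring
  · rw [tendsto_zero_iff_norm_tendsto_zero]
    refine tendsto_zero_of_sq_le (b := fun n => B * ε n) (fun n => ?_)
      (by simpa using hεlim.const_mul B)
    have h := norm_sub_one_sub_sq_le (hα n) (h1 n) (h3 n)
    rw [add_sub_cancel] at h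
    exact h.trans (mul_le_mul_of_nonneg_right (by linarith [haB n]) (hε0 n))

/-- Quadratic growth of orbits of positive hyperbolic step. -/
theorem mul_sq_le_sinhSq (hmono : Monotone fun n => (Z n).im)
    (hanti : ∀ m, Antitone fun n => sinhSq (Z (n + m)) (Z n)) (hD0 : 0 < D)
    (hD : Tendsto (fun n => sinhSq (Z (n + 1)) (Z n)) atTop (𝓝 D))
    (hp : ∀ n, ‖((Z (n + 2) : ℂ) - Z (n + 1)) - ((Z (n + 1) : ℂ) - Z n)‖ ^ 2 *
        ((Z (n + 1)).im * (Z n).im) ≤ ‖(Z (n + 1) : ℂ) - Z n‖ ^ 2 *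
        (((Z (n + 2)).im - (Z (n + 1)).im) * ((Z (n + 1)).im - (Z n).im))) (m n : ℕ) :
    D * m ^ 2 ≤ sinhSq (Z (n + m)) (Z n) := by
  obtain ⟨hlim1, hlim2⟩ := tendsto_step_ratio hmono (hanti 1) hD0 hD hp
  set a : ℕ → ℝ := fun n => (Z (n + 1)).im / (Z n).im with ha
  set ω : ℕ → ℂ := fun n => ((Z (n + 2) : ℂ) - Z (n + 1)) / ((Z (n + 1) : ℂ) - Z n) with hω
  have hy : ∀ n, 0 < (Z n).im := fun n => (Z n).im_pos
  have hP : ∀ n, ‖(Z (n + 1) : ℂ) - Z n‖ ^ 2 =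
      sinhSq (Z (n + 1)) (Z n) * ((Z (n + 1)).im * (Z n).im) := fun n => norm_sq_eq_sinhSq _ _
  have hPpos : ∀ n, 0 < ‖(Z (n + 1) : ℂ) - Z n‖ ^ 2 := fun n => by
    rw [hP]
    exact mul_pos (hD0.trans_le ((hanti 1).le_of_tendsto hD n)) (mul_pos (hy _) (hy _))
  have hPne : ∀ n, (Z (n + 1) : ℂ) - Z n ≠ 0 := fun n h => by
    have := hPpos n
    simp [h] at this
  have hamem : ∀ n, a n ∈ Set.Icc 1 (sinhSq (Z 1) (Z 0) + 2) := fun n =>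
    ⟨(one_le_div (hy n)).2 (hmono n.le_succ),
      (div_le_iff₀ (hy n)).2 (im_le_mul_of_sinhSq_le ((hanti 1) n.zero_le))⟩
  -- The ratios `a n` need not be known to converge: a cluster value `A` suffices, since consecutive
  -- ratios merge and so every shift has the same limit along `l`.
  obtain ⟨A, hA, φ, hφ, hlimA⟩ := isCompact_Icc.tendsto_subseq hamem
  have hA1 : 1 ≤ A := hA.1
  have hA0 : A ≠ 0 := by linarith
  set l : Filter ℕ := map φ atTop with hl
  have hle : l ≤ atTop := hφ.tendsto_atTop
  have hshift : ∀ k : ℕ, Tendsto (fun n => n + k) l atTop := fun k =>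
    (tendsto_add_atTop_nat k).mono_left hle
  have hak : ∀ k, Tendsto (fun n => a (n + k)) l (𝓝 A) := by
    intro k
    induction k with
    | zero => exact hlimA
    | succ k ih =>
      have := ih.add (hlim1.comp (hshift k))
      rw [add_zero] at this
      refine this.congr fun n => ?_
      change a (n + k) + (a (n + k + 1) - a (n + k)) = _
      rw [add_sub_cancel]
      rfl
  have hωk : ∀ k, Tendsto (fun n => ω (n + k)) l (𝓝 (A : ℂ)) := by
    intro k
    have := ((Complex.continuous_ofReal.tendsto A).comp (hak k)).add (hlim2.comp (hshift k))
    rw [add_zero] at this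
    refine this.congr fun n => ?_
    change (a (n + k) : ℂ) + (ω (n + k) - (a (n + k) : ℂ)) = _
    rw [add_sub_cancel]
  have hyk : ∀ k, Tendsto (fun n => (Z (n + k)).im / (Z n).im) l (𝓝 (A ^ k)) := by
    intro k
    induction k with
    | zero => simp [div_self (hy _).ne']
    | succ k ih =>
      rw [pow_succ]
      refine (ih.mul (hak k)).congr fun n => ?_
      have := (hy (n + k)).ne'
      have := (hy n).ne'
      simp only [ha, ← add_assoc]
      field_simp
  have hPk : ∀ k, Tendsto (fun n => ((Z (n + k + 1) : ℂ) - Z (n + k)) /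
      ((Z (n + 1) : ℂ) - Z n)) l (𝓝 ((A : ℂ) ^ k)) := by
    intro k
    induction k with
    | zero => simp [div_self (hPne _)]
    | succ k ih =>
      rw [pow_succ]
      refine (ih.mul (hωk k)).congr fun n => ?_
      have := hPne (n + k)
      have := hPne n
      simp only [hω, ← add_assoc]
      rw [show n + k + 1 + 1 = n + k + 2 from rfl]
      field_simp
  have hsum : Tendsto (fun n => ((Z (n + m) : ℂ) - Z n) / ((Z (n + 1) : ℂ) - Z n)) l
      (𝓝 (∑ k ∈ Finset.range m, (A : ℂ) ^ k)) := by
    refine (tendsto_finsetSum (Finset.range m) fun k _ => hPk k).congr fun n => ?_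
    have h := Finset.sum_range_sub (fun k => (Z (n + k) : ℂ)) m
    rw [← Finset.sum_div]
    exact congrArg (· / _) h
  have hQ : Tendsto (fun n => sinhSq (Z (n + m)) (Z n)) l
      (𝓝 (‖∑ k ∈ Finset.range m, (A : ℂ) ^ k‖ ^ 2 * (D * A) / A ^ m)) := by
    refine (((hsum.norm.pow 2).mul ((hD.mono_left hle).mul (hak 0))).div (hyk m)
      (pow_ne_zero _ hA0)).congr fun n => ?_
    have h1 := norm_pos_iff.2 (hPne n)
    have h2 := hy n
    have h3 := hy (n + 1)
    have h4 := hy (n + m)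
    simp only [Pi.div_apply, norm_div, div_pow, ha, sinhSq, add_zero]
    field_simp
  -- An antitone sequence dominates its limit along a subsequence, so the bound holds at every `n`.
  have hge : ‖∑ k ∈ Finset.range m, (A : ℂ) ^ k‖ ^ 2 * (D * A) / A ^ m ≤
      sinhSq (Z (n + m)) (Z n) :=
    le_of_tendsto hQ (((eventually_ge_atTop n).filter_mono hle).mono fun k hk => hanti m hk)
  refine le_trans ?_ hge
  have e : ‖∑ k ∈ Finset.range m, (A : ℂ) ^ k‖ ^ 2 = (∑ k ∈ Finset.range m, A ^ k) ^ 2 := by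
    rw [← Complex.normSq_eq_norm_sq]
    norm_cast
    rw [Complex.normSq_ofReal, sq]
  rw [e, le_div_iff₀ (by positivity)]
  have := mul_le_mul_of_nonneg_left (sq_mul_pow_le_geom_sum_sq hA1 m) hD0.le
  linarith

end QuadraticGrowth

theorem IsParabolicAtInfinity.mul_sq_le_sinhSq_iterate (hf : IsParabolicAtInfinity f) {z : ℍ}
    {D : ℝ} (hD0 : 0 < D)
    (hD : Tendsto (fun n : ℕ => sinhSq (f^[n + 1] z) (f^[n] z)) atTop (𝓝 D)) (m n : ℕ) :
    D * m ^ 2 ≤ sinhSq (f^[n + m] z) (f^[n] z) := by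
  refine mul_sq_le_sinhSq (Z := fun n => f^[n] z) (hf.monotone_im_iterate z) (fun m => ?_) hD0 hD
    (fun n => ?_) m n
  · simp only [Function.iterate_add_apply f _ m]
    exact antitone_sinhSq_iterate hf.holomorphic (f^[m] z) z
  · have := hf.schwarzPick_displacement (f^[n + 1] z) (f^[n] z)
    simpa only [Function.iterate_succ_apply'] using this

/-! ### Boundedness of the heights. -/

/-- An orbit of positive hyperbolic step that grows at most like `n √(Im fⁿ(z))` has bounded
imaginary part. -/
theorem IsParabolicAtInfinity.bddAbove_im_iterate (hf : IsParabolicAtInfinity f) {z : ℍ}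
    {D : ℝ} (hD0 : 0 < D)
    (hD : Tendsto (fun n : ℕ => sinhSq (f^[n + 1] z) (f^[n] z)) atTop (𝓝 D)) {K : ℝ}
    (hK : ∀ᶠ n : ℕ in atTop, ‖(f^[n] z : ℂ)‖ ≤ K * n * √(f^[n] z).im) :
    BddAbove (Set.range fun n : ℕ => (f^[n] z).im) := by
  refine ⟨K ^ 2 / D, Set.forall_mem_range.2 fun n => ?_⟩
  have hz := z.im_pos
  have hc : 0 < √z.im := Real.sqrt_pos.2 hz
  -- With `n` fixed, `C` collects the terms independent of `m` once `√(Im fⁿ⁺ᵐ(z)) ≥ √(Im z)` is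
  -- factored out.
  set C : ℝ := K * n + ‖(f^[n] z : ℂ)‖ / √z.im
  have hlim : Tendsto (fun m : ℕ => K + C / m) atTop (𝓝 (K + 0)) :=
    (tendsto_const_div_atTop_nhds_zero_nat C).const_add K
  rw [add_zero] at hlim
  have hev : ∀ᶠ m : ℕ in atTop, √(D * (f^[n] z).im) ≤ K + C / m := by
    filter_upwards [(tendsto_add_atTop_nat n).eventually hK, eventually_gt_atTop 0] with m hm hm0
    rw [add_comm m n] at hm
    have hm0' : (0 : ℝ) < m := by exact_mod_cast hm0
    have h1 := hf.mul_sq_le_sinhSq_iterate hD0 hD m n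
    have hy := (f^[n + m] z).im_pos
    have hy' := (f^[n] z).im_pos
    have h2 := norm_sq_eq_sinhSq (f^[n + m] z) (f^[n] z)
    set Y := (f^[n + m] z).im
    set y := (f^[n] z).im
    have hs : √z.im ≤ √Y := Real.sqrt_le_sqrt (hf.monotone_im_iterate z (n + m).zero_le)
    have hY : 0 < √Y := Real.sqrt_pos.2 hy
    have h3 : √(D * y) * m * √Y ≤ ‖(f^[n + m] z : ℂ) - f^[n] z‖ := by
      apply le_of_sq_le_sq _ (norm_nonneg _)
      rw [h2, mul_pow, mul_pow, Real.sq_sqrt (by positivity), Real.sq_sqrt hy.le]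
      have := mul_le_mul_of_nonneg_right h1 (by positivity : 0 ≤ Y * y)
      linarith
    have h4 : ‖(f^[n + m] z : ℂ) - f^[n] z‖ ≤ K * (n + m) * √Y + ‖(f^[n] z : ℂ)‖ := by
      refine (norm_sub_le _ _).trans ?_
      push_cast at hm
      linarith
    have h5 : ‖(f^[n] z : ℂ)‖ ≤ ‖(f^[n] z : ℂ)‖ / √z.im * √Y := by
      rw [div_mul_eq_mul_div, le_div_iff₀ hc]
      exact mul_le_mul_of_nonneg_left hs (norm_nonneg _)
    have h6 : √(D * y) * m * √Y ≤ (K * m + C) * √Y := by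
      simp only [C]
      linarith
    have h7 := le_of_mul_le_mul_right h6 hY
    have h8 : K + C / m = (K * m + C) / m := by field_simp
    rwa [h8, le_div_iff₀ hm0']
  have h := ge_of_tendsto hlim hev
  have hy' := (f^[n] z).im_pos
  have h2 := pow_le_pow_left₀ (Real.sqrt_nonneg _) h 2
  rw [Real.sq_sqrt (by positivity)] at h2
  rw [le_div_iff₀ hD0]
  linarith

theorem IsParabolicAtInfinity.tendsto_im_iterate (hf : IsParabolicAtInfinity f) {z : ℍ}
    (hb : BddAbove (Set.range fun n : ℕ => (f^[n] z).im)) :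
    ∃ I : ℝ, 0 < I ∧ Tendsto (fun n : ℕ => (f^[n] z).im) atTop (𝓝 I) :=
  ⟨_, z.im_pos.trans_le (le_ciSup hb 0), tendsto_atTop_ciSup (hf.monotone_im_iterate z) hb⟩

theorem bddAbove_im_iterate_of_bddAbove (hf : MDifferentiable 𝓘(ℂ) 𝓘(ℂ) f) {z : ℍ} (w : ℍ)
    (hb : BddAbove (Set.range fun n : ℕ => (f^[n] z).im)) :
    BddAbove (Set.range fun n : ℕ => (f^[n] w).im) := by
  obtain ⟨M, hM⟩ := hb
  refine ⟨(sinhSq w z + 2) * M, Set.forall_mem_range.2 fun n => ?_⟩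
  have h : (f^[n] w).im ≤ (sinhSq w z + 2) * (f^[n] z).im :=
    im_le_mul_of_sinhSq_le (antitone_sinhSq_iterate hf w z n.zero_le)
  have := sinhSq_nonneg w z
  exact h.trans (mul_le_mul_of_nonneg_left (hM ⟨n, rfl⟩) (by linarith))

/-! ### Asymptotics of orbits with bounded heights. -/

theorem IsParabolicAtInfinity.tendsto_displacement (hf : IsParabolicAtInfinity f) {z : ℍ}
    {D : ℝ} (hD0 : 0 < D)
    (hD : Tendsto (fun n : ℕ => sinhSq (f^[n + 1] z) (f^[n] z)) atTop (𝓝 D))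
    (hb : BddAbove (Set.range fun n : ℕ => (f^[n] z).im)) :
    ∃ L : ℝ, L ≠ 0 ∧
      Tendsto (fun n : ℕ => (f^[n + 1] z : ℂ) - f^[n] z) atTop (𝓝 (L : ℂ)) := by
  obtain ⟨I, hI0, hI⟩ := hf.tendsto_im_iterate hb
  obtain ⟨M, hM⟩ := hb
  have hmono := hf.monotone_im_iterate z
  set y : ℕ → ℝ := fun n => (f^[n] z).im with hy
  have hy0 : ∀ n, 0 < y n := fun n => (f^[n] z).im_pos
  have hyM : ∀ n, y n ≤ M := fun n => hM ⟨n, rfl⟩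
  set P : ℕ → ℂ := fun n => (f^[n + 1] z : ℂ) - f^[n] z with hP
  set C := sinhSq (f z) z
  have hC : 0 ≤ C := sinhSq_nonneg _ _
  have hv : ∀ n, 0 ≤ y (n + 1) - y n := fun n => sub_nonneg.2 (hmono n.le_succ)
  -- Schwarz–Pick bounds the distance by `√C` times the geometric mean of two height increments,
  -- hence by their sum, which telescopes.
  have hstep : ∀ n, dist (P n) (P (n + 1)) ≤
      √C * ((y (n + 1) - y n) + (y (n + 2) - y (n + 1))) := by
    intro n
    have h1 := hf.schwarzPick_displacement (f^[n + 1] z) (f^[n] z)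
    rw [norm_sq_eq_sinhSq] at h1
    have h2 : sinhSq (f^[n + 1] z) (f^[n] z) ≤ C :=
      antitone_sinhSq_iterate hf.holomorphic (f z) z n.zero_le
    rw [← Function.iterate_succ_apply' f, ← Function.iterate_succ_apply' f] at h1
    rw [dist_comm, dist_eq_norm]
    apply le_of_sq_le_sq _ (by have := hv n; have := hv (n + 1); positivity)
    rw [mul_pow, Real.sq_sqrt hC]
    have h3 : ‖P (n + 1) - P n‖ ^ 2 * (y (n + 1) * y n) ≤
        sinhSq (f^[n + 1] z) (f^[n] z) * (y (n + 1) * y n) *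
          ((y (n + 2) - y (n + 1)) * (y (n + 1) - y n)) := h1
    have h4 : 0 < y (n + 1) * y n := mul_pos (hy0 _) (hy0 _)
    have h5 : ‖P (n + 1) - P n‖ ^ 2 ≤ sinhSq (f^[n + 1] z) (f^[n] z) *
          ((y (n + 2) - y (n + 1)) * (y (n + 1) - y n)) := by
      refine le_of_mul_le_mul_right ?_ h4
      linarith
    have h6 := mul_nonneg (hv (n + 1)) (hv n)
    calc _ ≤ _ := h5
      _ ≤ C * ((y (n + 2) - y (n + 1)) * (y (n + 1) - y n)) := mul_le_mul_of_nonneg_right h2 h6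
      _ ≤ _ := mul_le_mul_of_nonneg_left
        (by nlinarith [sq_nonneg (y (n + 2) - y (n + 1)), sq_nonneg (y (n + 1) - y n)]) hC
  have hsum : Summable fun n => √C * ((y (n + 1) - y n) + (y (n + 2) - y (n + 1))) := by
    apply Summable.mul_left
    refine summable_of_sum_range_le (c := 2 * M) (fun n => add_nonneg (hv n) (hv (n + 1)))
      fun n => ?_
    rw [Finset.sum_add_distrib, Finset.sum_range_sub y, Finset.sum_range_sub fun i => y (i + 1)]
    linarith [hyM n, hyM (n + 1), hy0 0, hy0 1]
  obtain ⟨L, hL⟩ := cauchySeq_tendsto_of_complete (cauchySeq_of_dist_le_of_summable _ hstep hsum)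
  have hI1 : Tendsto (fun n => y (n + 1)) atTop (𝓝 I) := (tendsto_add_atTop_iff_nat 1).2 hI
  have him : L.im = 0 := by
    have h1 : Tendsto (fun n => (P n).im) atTop (𝓝 L.im) :=
      (Complex.continuous_im.tendsto _).comp hL
    have h2 : Tendsto (fun n => (P n).im) atTop (𝓝 (I - I)) := hI1.sub hI
    rw [sub_self] at h2
    exact tendsto_nhds_unique h1 h2
  have hnorm : ‖L‖ ^ 2 = D * (I * I) := by
    refine tendsto_nhds_unique (hL.norm.pow 2) ((hD.mul (hI1.mul hI)).congr fun n => ?_)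
    exact (norm_sq_eq_sinhSq _ _).symm
  have hLre : (L.re : ℂ) = L := Complex.ext rfl (by simp [him])
  refine ⟨L.re, fun h => ?_, hLre ▸ hL⟩
  rw [h] at hLre
  rw [← hLre] at hnorm
  have : 0 < D * (I * I) := by positivity
  simp at hnorm
  rcases hnorm with h | h <;> linarith

/-- Schwarz–Pick bounds the squared difference of the two displacements by `sinhSq w z` times the
product of the height increments, which tends to `0`. This makes `L` independent of the orbit. -/
theorem IsParabolicAtInfinity.tendsto_displacement_of_tendsto (hf : IsParabolicAtInfinity f)
    {z : ℍ} (hb : BddAbove (Set.range fun n : ℕ => (f^[n] z).im)) {L : ℂ}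
    (hL : Tendsto (fun n : ℕ => (f^[n + 1] z : ℂ) - f^[n] z) atTop (𝓝 L)) (w : ℍ) :
    Tendsto (fun n : ℕ => (f^[n + 1] w : ℂ) - f^[n] w) atTop (𝓝 L) := by
  have him : ∀ u : ℍ, BddAbove (Set.range fun n : ℕ => (f^[n] u).im) →
      Tendsto (fun n : ℕ => (f^[n + 1] u).im - (f^[n] u).im) atTop (𝓝 0) := by
    intro u hu
    obtain ⟨I, -, hI⟩ := hf.tendsto_im_iterate hu
    simpa using ((tendsto_add_atTop_iff_nat 1).2 hI).sub hI
  have hw := him w (bddAbove_im_iterate_of_bddAbove hf.holomorphic w hb)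
  have hz := him z hb
  set p : ℍ → ℕ → ℂ := fun u n => (f^[n + 1] u : ℂ) - f^[n] u with hp
  have hdiff : Tendsto (fun n => ‖p w n - p z n‖) atTop (𝓝 0) := by
    refine tendsto_zero_of_sq_le (fun n => ?_)
      (by simpa using (hw.mul hz).const_mul (sinhSq w z))
    have h1 := hf.schwarzPick_displacement (f^[n] w) (f^[n] z)
    rw [norm_sq_eq_sinhSq, ← Function.iterate_succ_apply' f, ← Function.iterate_succ_apply' f]
      at h1
    have h2 : sinhSq (f^[n] w) (f^[n] z) ≤ sinhSq w z :=
      antitone_sinhSq_iterate hf.holomorphic w z n.zero_le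
    have h4 := mul_pos (f^[n] w).im_pos (f^[n] z).im_pos
    have h5 : ‖p w n - p z n‖ ^ 2 ≤ sinhSq (f^[n] w) (f^[n] z) *
        (((f^[n + 1] w).im - (f^[n] w).im) * ((f^[n + 1] z).im - (f^[n] z).im)) := by
      refine le_of_mul_le_mul_right ?_ h4
      simp only [Nat.succ_eq_add_one] at h1
      simp only [hp]
      linarith
    refine h5.trans (mul_le_mul_of_nonneg_right h2 (mul_nonneg ?_ ?_))
    · exact sub_nonneg.2 (hf.monotone_im_iterate w n.le_succ)
    · exact sub_nonneg.2 (hf.monotone_im_iterate z n.le_succ)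
  have := (tendsto_zero_iff_norm_tendsto_zero.2 hdiff).add hL
  rw [zero_add] at this
  exact this.congr fun n => sub_add_cancel _ _

theorem tendsto_div_natCast_of_tendsto_sub {u : ℕ → ℂ} {L : ℂ}
    (h : Tendsto (fun n => u (n + 1) - u n) atTop (𝓝 L)) :
    Tendsto (fun n : ℕ => u n / n) atTop (𝓝 L) := by
  have h1 := h.cesaro_smul
  have h2 : Tendsto (fun n : ℕ => u 0 / n) atTop (𝓝 0) := tendsto_const_div_atTop_nhds_zero_nat _
  have h3 := h1.add h2
  rw [add_zero] at h3
  refine h3.congr fun n => ?_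
  rw [Finset.sum_range_sub, Complex.real_smul]
  push_cast
  ring

/-- In the formula `hypDist_I`, after division by `n` the shifts `±i/n` disappear in the limit. -/
theorem tendsto_hypDist_I_sub_log {Z : ℕ → ℍ} {L I : ℝ} (hL0 : L ≠ 0) (hI0 : 0 < I)
    (hL : Tendsto (fun n : ℕ => (Z n : ℂ) / n) atTop (𝓝 (L : ℂ)))
    (hI : Tendsto (fun n => (Z n).im) atTop (𝓝 I)) :
    Tendsto (fun n : ℕ => hypDist UpperHalfPlane.I (Z n) - Real.log n) atTop
      (𝓝 (Real.log (|L| / √I))) := by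
  have hn : Tendsto (fun n : ℕ => Complex.I / n) atTop (𝓝 0) :=
    tendsto_const_div_atTop_nhds_zero_nat _
  have hsI : 0 < √I := Real.sqrt_pos.2 hI0
  have h1 := ((hL.add hn).norm.add (hL.sub hn).norm).div (hI.sqrt.const_mul 2) (by positivity)
  have e : (‖(L : ℂ) + 0‖ + ‖(L : ℂ) - 0‖) / (2 * √I) = |L| / √I := by
    rw [add_zero, sub_zero, Complex.norm_real, Real.norm_eq_abs]
    field_simp
    ring
  rw [e] at h1
  have h2 := h1.log (div_pos (abs_pos.2 hL0) hsI).ne'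
  refine h2.congr' ?_
  filter_upwards [eventually_gt_atTop 0] with n hn0
  have hn0' : (0 : ℝ) < n := by exact_mod_cast hn0
  have hy := Real.sqrt_pos.2 (Z n).im_pos
  have hpos : 0 < ‖(Z n : ℂ) + Complex.I‖ := by
    refine norm_pos_iff.2 fun h => ?_
    have h' := congrArg Complex.im h
    have := (Z n).im_pos
    simp at h'
    linarith
  rw [hypDist_I, ← Real.log_div (by positivity) hn0'.ne']
  simp only [Pi.div_apply, ← add_div, ← sub_div, norm_div, Complex.norm_natCast]
  congr 1
  field_simp

/-! ### Each condition forces bounded heights. -/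

theorem norm_le_mul_norm_of_sinhSq_le {z w : ℍ} {K : ℝ} (h : sinhSq z w ≤ K) :
    ‖(z : ℂ)‖ ≤ (K + 3) * ‖(w : ℂ)‖ := by
  have h0 := (sinhSq_nonneg z w).trans h
  have h1 := im_le_mul_of_sinhSq_le h
  have h2 : w.im ≤ ‖(w : ℂ)‖ := (le_abs_self _).trans (Complex.abs_im_le_norm (w : ℂ))
  have hw := w.im_pos
  have hz := z.im_pos
  have h3 : ‖(z : ℂ) - w‖ ≤ (K + 2) * ‖(w : ℂ)‖ := by
    apply le_of_sq_le_sq _ (by positivity)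
    calc ‖(z : ℂ) - w‖ ^ 2 = sinhSq z w * (z.im * w.im) := norm_sq_eq_sinhSq z w
      _ ≤ (K + 2) * (((K + 2) * w.im) * w.im) := by
        gcongr
        linarith
      _ = ((K + 2) * w.im) ^ 2 := by ring
      _ ≤ _ := by gcongr
  calc ‖(z : ℂ)‖ = ‖((z : ℂ) - w) + w‖ := by rw [sub_add_cancel]
    _ ≤ ‖(z : ℂ) - w‖ + ‖(w : ℂ)‖ := norm_add_le _ _
    _ ≤ _ := by linarith

theorem norm_le_exp_mul_of_hypDist_I_le {z : ℍ} {n : ℕ} (hn : 0 < n) {l : ℝ}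
    (h : hypDist UpperHalfPlane.I z - Real.log n ≤ l) :
    ‖(z : ℂ)‖ ≤ Real.exp l * n * √z.im := by
  have hn' : (0 : ℝ) < n := by exact_mod_cast hn
  have hy := Real.sqrt_pos.2 z.im_pos
  have hle : 2 * ‖(z : ℂ)‖ ≤ ‖(z : ℂ) + Complex.I‖ + ‖(z : ℂ) - Complex.I‖ := by
    calc 2 * ‖(z : ℂ)‖ = ‖((z : ℂ) + Complex.I) + ((z : ℂ) - Complex.I)‖ := by
          rw [add_add_sub_cancel, ← two_mul, norm_mul, Complex.norm_ofNat]
      _ ≤ _ := norm_add_le _ _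
  have hz := norm_pos_iff.2 z.ne_zero
  have h1 : Real.log ((‖(z : ℂ) + Complex.I‖ + ‖(z : ℂ) - Complex.I‖) / (2 * √z.im)) ≤
      l + Real.log n := by
    rw [← hypDist_I]
    linarith
  rw [Real.log_le_iff_le_exp (div_pos (by linarith) (by positivity)), Real.exp_add,
    Real.exp_log hn', div_le_iff₀ (by positivity)] at h1
  linarith

/-- The rate is known on the orbit of some `w`, the positive step on that of `z`; orbits at bounded
hyperbolic distance have comparable moduli, so linear growth transfers. -/
theorem bddAbove_im_iterate_of_extremalRate (hf : IsParabolicAtInfinity f) {z : ℍ} {D : ℝ}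
    (hD0 : 0 < D)
    (hD : Tendsto (fun n : ℕ => sinhSq (f^[n + 1] z) (f^[n] z)) atTop (𝓝 D))
    (h : ExtremalRate f) : BddAbove (Set.range fun n : ℕ => (f^[n] z).im) := by
  obtain ⟨w, L, -, hL⟩ := h
  have hc : 0 < √z.im := Real.sqrt_pos.2 z.im_pos
  set S := sinhSq z w
  have hS : 0 ≤ S := sinhSq_nonneg z w
  apply hf.bddAbove_im_iterate hD0 hD (K := (S + 3) * (‖(L : ℂ)‖ + 1) / √z.im)
  filter_upwards [hL.norm.eventually_le_const (lt_add_one ‖(L : ℂ)‖), eventually_gt_atTop 0]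
    with n h1 hn
  have hn' : (0 : ℝ) < n := by exact_mod_cast hn
  rw [norm_div, Complex.norm_natCast, div_le_iff₀ hn'] at h1
  have h2 : ‖(f^[n] z : ℂ)‖ ≤ (S + 3) * ‖(f^[n] w : ℂ)‖ :=
    norm_le_mul_norm_of_sinhSq_le (antitone_sinhSq_iterate hf.holomorphic z w n.zero_le)
  have h3 : √z.im ≤ √(f^[n] z).im := Real.sqrt_le_sqrt (hf.monotone_im_iterate z n.zero_le)
  calc ‖(f^[n] z : ℂ)‖ ≤ (S + 3) * ((‖(L : ℂ)‖ + 1) * n) := h2.trans (by gcongr)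
    _ = (S + 3) * (‖(L : ℂ)‖ + 1) / √z.im * n * √z.im := by field_simp
    _ ≤ _ := by gcongr

theorem bddAbove_im_iterate_of_tendsto_hypDist (hf : IsParabolicAtInfinity f) {z : ℍ} {D : ℝ}
    (hD0 : 0 < D)
    (hD : Tendsto (fun n : ℕ => sinhSq (f^[n + 1] z) (f^[n] z)) atTop (𝓝 D)) {l : ℝ}
    (h : Tendsto (fun n : ℕ => hypDist UpperHalfPlane.I (f^[n] z) - Real.log n) atTop (𝓝 l)) :
    BddAbove (Set.range fun n : ℕ => (f^[n] z).im) := by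
  apply hf.bddAbove_im_iterate hD0 hD (K := Real.exp (l + 1))
  filter_upwards [h.eventually_le_const (lt_add_one l), eventually_gt_atTop 0] with n h1 hn
  exact norm_le_exp_mul_of_hypDist_I_le hn h1

theorem FiniteShift.bddAbove_im_iterate (hf : MDifferentiable 𝓘(ℂ) 𝓘(ℂ) f)
    (h : FiniteShift f) (z : ℍ) : BddAbove (Set.range fun n : ℕ => (f^[n] z).im) := by
  obtain ⟨w, I, hI⟩ := h
  exact bddAbove_im_iterate_of_bddAbove hf z hI.bddAbove_range

theorem IsParabolicAtInfinity.asymptotics_of_bddAbove (hf : IsParabolicAtInfinity f) {z : ℍ}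
    {D : ℝ} (hD0 : 0 < D)
    (hD : Tendsto (fun n : ℕ => sinhSq (f^[n + 1] z) (f^[n] z)) atTop (𝓝 D))
    (hb : BddAbove (Set.range fun n : ℕ => (f^[n] z).im)) :
    ∃ L : ℝ, L ≠ 0 ∧ ∀ w : ℍ,
      Tendsto (fun n : ℕ => (f^[n] w : ℂ) / (n : ℂ)) atTop (𝓝 (L : ℂ)) ∧
      ∃ Iw : ℝ, 0 < Iw ∧ Tendsto (fun n : ℕ => (f^[n] w).im) atTop (𝓝 Iw) ∧
        Tendsto (fun n : ℕ => hypDist UpperHalfPlane.I (f^[n] w) - Real.log n) atTop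
          (𝓝 (Real.log (|L| / √Iw))) := by
  obtain ⟨L, hL0, hL⟩ := hf.tendsto_displacement hD0 hD hb
  refine ⟨L, hL0, fun w => ?_⟩
  have hLw := tendsto_div_natCast_of_tendsto_sub (u := fun n => (f^[n] w : ℂ))
    (hf.tendsto_displacement_of_tendsto hb hL w)
  obtain ⟨I, hI0, hI⟩ :=
    hf.tendsto_im_iterate (bddAbove_im_iterate_of_bddAbove hf.holomorphic w hb)
  exact ⟨hLw, I, hI0, hI, tendsto_hypDist_I_sub_log hL0 hI0 hLw hI⟩

end HalfPlaneDynamics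

/-! ### The equivalences, all through bounded heights of one orbit. -/

theorem theorem7p4 (f : UpperHalfPlane → UpperHalfPlane)
    (hf : HalfPlaneDynamics.IsParabolicAtInfinity f)
    (hstep : HalfPlaneDynamics.PositiveHyperbolicStep f) :
    (HalfPlaneDynamics.ExtremalRate f ↔ HalfPlaneDynamics.FiniteShift f) ∧
    (HalfPlaneDynamics.ExtremalRate f ↔
      ∀ z : UpperHalfPlane, ∃ l : ℝ,
        Tendsto (fun n : ℕ => HalfPlaneDynamics.hypDist UpperHalfPlane.I (f^[n] z) - Real.log n)
          atTop (𝓝 l)) ∧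
    (HalfPlaneDynamics.ExtremalRate f →
      ∃ L : ℝ, L ≠ 0 ∧ ∀ z : UpperHalfPlane,
        Tendsto (fun n : ℕ => (f^[n] z : ℂ) / (n : ℂ)) atTop (𝓝 (L : ℂ)) ∧
        ∃ Iz : ℝ, 0 < Iz ∧
          Tendsto (fun n : ℕ => (f^[n] z).im) atTop (𝓝 Iz) ∧
          Tendsto (fun n : ℕ => HalfPlaneDynamics.hypDist UpperHalfPlane.I (f^[n] z) - Real.log n)
            atTop (𝓝 (Real.log (|L| / √Iz)))) := by
  obtain ⟨z₀, D, hD0, hD⟩ := hstep.exists_tendsto_sinhSq hf.holomorphic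
  have asymp := fun hb => hf.asymptotics_of_bddAbove hD0 hD hb
  have of_rate := fun h => asymp
    (HalfPlaneDynamics.bddAbove_im_iterate_of_extremalRate hf hD0 hD h)
  have to_rate : BddAbove (Set.range fun n : ℕ => (f^[n] z₀).im) →
      HalfPlaneDynamics.ExtremalRate f := fun hb => by
    obtain ⟨L, hL0, hL⟩ := asymp hb
    exact ⟨z₀, L, hL0, (hL z₀).1⟩
  refine ⟨⟨fun h => ?_, fun h => to_rate (h.bddAbove_im_iterate hf.holomorphic z₀)⟩,
    ⟨fun h z => ?_, fun h => ?_⟩, of_rate⟩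
  · obtain ⟨L, -, hL⟩ := of_rate h
    obtain ⟨-, I, -, hI, -⟩ := hL z₀
    exact ⟨z₀, I, hI⟩
  · obtain ⟨L, -, hL⟩ := of_rate h
    obtain ⟨-, I, -, -, hI⟩ := hL z
    exact ⟨_, hI⟩
  · obtain ⟨l, hl⟩ := h z₀
    exact to_rate (HalfPlaneDynamics.bddAbove_im_iterate_of_tendsto_hypDist hf hD0 hD hl)
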